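/- Let $\mathcal H$ be a finite-dimensional complex Hilbert space and let $A_1,\dots,A_r$ be positive semidefinite operators on $\mathcal H$. Put $p_k:=\operatorname{Tr}A_k$ and $\sigma_k:=A_k/\operatorname{Tr}A_k$ (if $A_k=0$, any term below that carries the factor $\sqrt{p_k p_j}=0$ is read as $0$). Conventions. Powers of a positive semidefinite operator $A$ are taken on its support, i.e. $A^s:=\sum_{a>0}a^sP_a$ for $s\in\mathbb R$, where $a$ runs over the strictly positive eigenvalues of $A$ and $P_a$ are the spectral projections. A POVM is a family of positive semidefinite operators $E_1,\dots,E_r$ with $E_1+\dots+E_r\le I$. The optimal error probability is $P_e^*(A_1,\dots,A_r):=\min\{\sum_{i=1}^r\operatorname{Tr}A_i(I-E_i):\{E_i\}\text{ a POVM}\}$; in particular $P_e^*(A_i,A_j)$ is this quantity for the two operators $A_i,A_j$. The fidelity is $F(A,B):=\|A^{1/2}B^{1/2}\|_1$, where $\|X\|_1:=\operatorname{Tr}(X^*X)^{1/2}$, and $Q_{\min}(A,B):=\min_{0\le s\le1}\operatorname{Tr}A^sB^{1-s}$. All sums below are over ordered pairs $(i,j)\in\{1,\dots,r\}^2$ with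 $i\ne j$. Then $$P_e^*(A_1,\dots,A_r)\le\sum_{(i,j):i\ne j}\operatorname{Tr}A_i^{1/2}A_j^{1/2}\le\sum_{(i,j):i\ne j}F(A_i,A_j),$$ and the last sum satisfies both $$\sum_{(i,j):i\ne j}F(A_i,A_j)\le\sum_{(i,j):i\ne j}\sqrt{p_i+p_j}\;P_e^*(A_i,A_j)^{1/2}$$ and $$\sum_{(i,j):i\ne j}F(A_i,A_j)\le\sum_{(i,j):i\ne j}\sqrt{p_ip_j}\;Q_{\min}(\sigma_i,\sigma_j)^{1/2}.$$ If moreover every $\sigma_k$ is a pure state, i.e. $\sigma_k=|\psi_k\rangle\langle\psi_k|$ for a unit vector $\psi_k\in\mathcal H$, then $$P_e^*(A_1,\dots,A_r)\le\sum_{(i,j):i\ne j}\operatorname{Tr}A_i^{1/2}A_j^{1/2}=\sum_{(i,j):i\ne j}\sqrt{p_ip_j}\;Q_{\min}(\sigma_i,\sigma_j)=\sum_{(i,j):i\ne j}\frac{1}{\sqrt{p_ip_j}}F(A_i,A_j)^2\le\sum_{(i,j):i\ne j}\frac{p_i+p_j}{\sqrt{p_ip_j}}\;P_e^*(A_i,A_j).$$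 -/

import Mathlib

namespace StateDiscrimination

noncomputable section

/-- The trace of an operator on a finite-dimensional Hilbert space, as a real number. It is only
applied to operators of the form `X * Y` with `X`, `Y` positive semidefinite, or to positive
semidefinite operators, whose complex trace is real. -/
def tr {H : Type*} [NormedAddCommGroup H] [InnerProductSpace ℂ H] (X : H →L[ℂ] H) : ℝ :=
  (LinearMap.trace ℂ H (X : H →ₗ[ℂ] H)).re

/-- The power `A ^ s` of a positive semidefinite operator, taken on its support only: the zero
eigenvalue is sent to `0` for every real `s`, so that `A ^ 0` is the projection onto the support
of `A`. In finite dimension the spectrum of `A` is finite, hence the functional calculus applies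
to every function. -/
def psdPow {H : Type*} [NormedAddCommGroup H] [InnerProductSpace ℂ H] [CompleteSpace H]
    (A : H →L[ℂ] H) (s : ℝ) : H →L[ℂ] H :=
  cfc (fun x : ℝ => if x = 0 then 0 else x ^ s) A

/-- The trace norm `‖X‖₁ = Tr (X* X)^{1/2}`. -/
def traceNorm {H : Type*} [NormedAddCommGroup H] [InnerProductSpace ℂ H] [CompleteSpace H]
    (X : H →L[ℂ] H) : ℝ :=
  tr (CFC.abs X)

/-- A POVM with outcomes `1, …, r`: positive semidefinite operators with `E₁ + ⋯ + E_r ≤ I` (in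
the order `X ≤ Y ↔ (Y - X).IsPositive`). -/
structure IsPOVM {H : Type*} [NormedAddCommGroup H] [InnerProductSpace ℂ H] [CompleteSpace H]
    {r : ℕ} (E : Fin r → H →L[ℂ] H) : Prop where
  isPositive : ∀ i, (E i).IsPositive
  sum_le_one : ∑ i, E i ≤ 1

/-- The error probability `∑ i, Tr A_i (I - E_i)` of a measurement `E` for the hypotheses `A`. -/
def errorProb {H : Type*} [NormedAddCommGroup H] [InnerProductSpace ℂ H]
    {r : ℕ} (A E : Fin r → H →L[ℂ] H) : ℝ :=
  ∑ i, tr (A i * (1 - E i))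

/-- The optimal error probability `P_e^*(A_1, …, A_r)`, the minimum of the error probabilities of
all POVMs. -/
def optError {H : Type*} [NormedAddCommGroup H] [InnerProductSpace ℂ H] [CompleteSpace H]
    {r : ℕ} (A : Fin r → H →L[ℂ] H) : ℝ :=
  sInf {e : ℝ | ∃ E : Fin r → H →L[ℂ] H, IsPOVM E ∧ e = errorProb A E}

/-- The fidelity `F(A, B) = ‖A^{1/2} B^{1/2}‖₁`. -/
def fidelity {H : Type*} [NormedAddCommGroup H] [InnerProductSpace ℂ H] [CompleteSpace H]
    (A B : H →L[ℂ] H) : ℝ :=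
  traceNorm (psdPow A (1 / 2) * psdPow B (1 / 2))

/-- `Q_s(A‖B) = Tr A^s B^{1-s}`. -/
def chernoffQ {H : Type*} [NormedAddCommGroup H] [InnerProductSpace ℂ H] [CompleteSpace H]
    (s : ℝ) (A B : H →L[ℂ] H) : ℝ :=
  tr (psdPow A s * psdPow B (1 - s))

/-- `Q_min(A, B)`, the minimum of `Q_s(A‖B)` over `0 ≤ s ≤ 1`. -/
def chernoffQmin {H : Type*} [NormedAddCommGroup H] [InnerProductSpace ℂ H] [CompleteSpace H]
    (A B : H →L[ℂ] H) : ℝ :=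
  sInf ((fun s : ℝ => chernoffQ s A B) '' Set.Icc 0 1)

/-- The normalization `σ = A / Tr A` of a positive semidefinite operator. -/
def normalized {H : Type*} [NormedAddCommGroup H] [InnerProductSpace ℂ H]
    (A : H →L[ℂ] H) : H →L[ℂ] H :=
  (((tr A)⁻¹ : ℝ) : ℂ) • A

/-- A pure state: the rank-one projection `|ψ⟩⟨ψ|` of a unit vector `ψ`. -/
def IsPureState {H : Type*} [NormedAddCommGroup H] [InnerProductSpace ℂ H]
    (ρ : H →L[ℂ] H) : Prop :=
  ∃ ψ : H, ‖ψ‖ = 1 ∧ ρ = InnerProductSpace.rankOne ℂ ψ ψ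

end

end StateDiscrimination

/-! The multi-hypothesis bound comes from an explicit measurement: with `B i = A_i^{1/2}` and `S = ∑
B i + ε`, take `E i = S^{-1/2} B i S^{-1/2}`. The term `ε` makes `S` invertible. By
`two_mul_tr_pow_le`, a combination of three positive Hilbert–Schmidt squares, the `i`-th error is at
most `Tr S B_i - Tr B_i²`. Summing over `i` leaves the off-diagonal overlaps plus `ε ∑ Tr B_i`, and
`ε` tends to `0`.

The pairwise bounds start from `F(A, B) = Tr U* A^{1/2} B^{1/2}`, with `U` the partial isometry of
the polar decomposition, followed by the Cauchy–Schwarz inequality. Splitting the powers as `1/2 =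
(1-s)/2 + s/2` gives `F² ≤ Q_s` (`sq_fidelity_le_chernoffQ`); inserting `1 = E + (1 - E)` between
the two roots gives the bound by the binary error (`sq_fidelity_le_mul_errorProb`).

A pure state is a projection, equal to all its powers, so `Q_s` does not depend on `s`, and `Q_min`
and the squared fidelity both equal `Tr ρτ`. -/

namespace StateDiscrimination

open scoped InnerProductSpace

set_option linter.unusedSectionVars false

/-! ### Real trace and Hilbert–Schmidt inner product. -/

section Trace

variable {H : Type*} [NormedAddCommGroup H] [InnerProductSpace ℂ H]

theorem tr_add (X Y : H →L[ℂ] H) : tr (X + Y) = tr X + tr Y := by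
  simp [tr]

theorem tr_sub (X Y : H →L[ℂ] H) : tr (X - Y) = tr X - tr Y := by
  simp [tr]

theorem tr_zero : tr (0 : H →L[ℂ] H) = 0 := by
  simp [tr]

theorem tr_smul (c : ℝ) (X : H →L[ℂ] H) : tr (c • X) = c * tr X := by
  have h : ((c • X : H →L[ℂ] H) : H →ₗ[ℂ] H) = (c : ℂ) • (X : H →ₗ[ℂ] H) := by
    ext x; simp
  simp [tr, h]

theorem tr_sum {ι : Type*} (s : Finset ι) (X : ι → H →L[ℂ] H) :
    tr (∑ i ∈ s, X i) = ∑ i ∈ s, tr (X i) := by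
  classical
  induction s using Finset.induction_on with
  | empty => simp [tr_zero]
  | insert i s hi ih => rw [Finset.sum_insert hi, Finset.sum_insert hi, tr_add, ih]

variable [FiniteDimensional ℂ H]

theorem tr_mul_comm (X Y : H →L[ℂ] H) : tr (X * Y) = tr (Y * X) := by
  simp only [tr, ContinuousLinearMap.toLinearMap_mul]
  rw [LinearMap.trace_mul_comm]

theorem tr_eq_sum {ι : Type*} [Fintype ι] (b : OrthonormalBasis ι ℂ H) (X : H →L[ℂ] H) :
    tr X = ∑ i, (⟪b i, X (b i)⟫_ℂ).re := by
  rw [tr, LinearMap.trace_eq_sum_inner _ b, Complex.re_sum]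
  rfl

variable [CompleteSpace H]

theorem tr_star (X : H →L[ℂ] H) : tr (star X) = tr X := by
  rw [tr_eq_sum (stdOrthonormalBasis ℂ H), tr_eq_sum (stdOrthonormalBasis ℂ H)]
  refine Finset.sum_congr rfl fun i _ => ?_
  rw [ContinuousLinearMap.star_eq_adjoint, ContinuousLinearMap.adjoint_inner_right,
    ← inner_conj_symm, Complex.conj_re]

theorem tr_nonneg {X : H →L[ℂ] H} (hX : 0 ≤ X) : 0 ≤ tr X := by
  rw [tr_eq_sum (stdOrthonormalBasis ℂ H)]
  exact Finset.sum_nonneg fun i _ =>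
    ((ContinuousLinearMap.nonneg_iff_isPositive X).1 hX).re_inner_nonneg_right _

theorem tr_star_mul_self_nonneg (X : H →L[ℂ] H) : 0 ≤ tr (star X * X) :=
  tr_nonneg (star_mul_self_nonneg X)

theorem tr_mul_nonneg {X Y : H →L[ℂ] H} (hX : 0 ≤ X) (hY : 0 ≤ Y) : 0 ≤ tr (X * Y) := by
  have h := tr_nonneg (star_left_conjugate_nonneg hY (CFC.sqrt X))
  rwa [tr_mul_comm, (CFC.sqrt_nonneg X).isSelfAdjoint.star_eq, ← mul_assoc,
    CFC.sqrt_mul_sqrt_self X hX] at h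

theorem tr_mul_le_tr_mul {X Y Z : H →L[ℂ] H} (hX : 0 ≤ X) (h : Y ≤ Z) :
    tr (X * Y) ≤ tr (X * Z) := by
  have := tr_mul_nonneg hX (sub_nonneg.2 h)
  rw [mul_sub, tr_sub] at this
  linarith

theorem tr_mul_le_tr {X Y : H →L[ℂ] H} (hX : 0 ≤ X) (h : Y ≤ 1) : tr (X * Y) ≤ tr X := by
  simpa using tr_mul_le_tr_mul hX h

/-- The Cauchy–Schwarz inequality for the Hilbert–Schmidt inner product. -/
theorem sq_tr_star_mul_le (X Y : H →L[ℂ] H) :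
    tr (star X * Y) ^ 2 ≤ tr (star X * X) * tr (star Y * Y) := by
  have key : ∀ t : ℝ, 0 ≤ tr (star X * X) * (t * t) + 2 * tr (star X * Y) * t
      + tr (star Y * Y) := by
    intro t
    have h := tr_star_mul_self_nonneg (t • X + Y)
    have hs : tr (star Y * X) = tr (star X * Y) := by
      rw [← tr_star, star_mul, star_star]
    simp only [star_add, star_smul, star_trivial, add_mul, mul_add, smul_mul_assoc,
      mul_smul_comm, tr_add, tr_smul, hs] at h
    linarith
  have := discrim_le_zero key
  rw [discrim] at this
  linarith

end Trace

/-! ### Functional calculus in finite dimension, via eigenbases. -/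

section FunctionalCalculus

variable {H : Type*} [NormedAddCommGroup H] [InnerProductSpace ℂ H] [CompleteSpace H]
  [FiniteDimensional ℂ H]

theorem finite_spectrum_real (A : H →L[ℂ] H) : (spectrum ℝ A).Finite := by
  have h : (spectrum ℂ A).Finite := by
    have := Module.End.finite_spectrum (A : H →ₗ[ℂ] H)
    refine this.subset fun z hz => ?_
    rw [spectrum.mem_iff] at hz ⊢
    intro hu
    apply hz
    rw [ContinuousLinearMap.isUnit_iff_bijective]
    exact (Module.End.isUnit_iff _).1 hu
  rw [← spectrum.preimage_algebraMap ℂ]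
  exact h.preimage (FaithfulSMul.algebraMap_injective ℝ ℂ).injOn

theorem continuousOn_spectrum (A : H →L[ℂ] H) (f : ℝ → ℝ) : ContinuousOn f (spectrum ℝ A) :=
  (finite_spectrum_real A).continuousOn f

theorem cfc_mul_cfc (A : H →L[ℂ] H) (f g : ℝ → ℝ) :
    cfc f A * cfc g A = cfc (fun x => f x * g x) A :=
  (cfc_mul f g A (continuousOn_spectrum A f) (continuousOn_spectrum A g)).symm

theorem star_cfc_real (A : H →L[ℂ] H) (f : ℝ → ℝ) : star (cfc f A) = cfc f A :=
  (cfc_predicate f A : IsSelfAdjoint (cfc f A)).star_eq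

/-- On a finite spectrum every function agrees with a polynomial, and a polynomial in `A` acts on an
eigenvector by evaluation at the eigenvalue. -/
theorem cfc_apply_eigenvector {A : H →L[ℂ] H} (hA : IsSelfAdjoint A) {v : H} {a : ℝ}
    (hv : A v = (a : ℂ) • v) (f : ℝ → ℝ) : cfc f A v = (f a : ℂ) • v := by
  classical
  rcases eq_or_ne v 0 with rfl | hv0
  · simp
  -- Adding `a` to the nodes avoids having to show that it lies in the spectrum.
  set s : Finset ℝ := insert a (finite_spectrum_real A).toFinset with hs
  set q : Polynomial ℝ := Lagrange.interpolate s id f with hq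
  have hqf : ∀ x ∈ s, q.eval x = f x := fun x hx =>
    Lagrange.eval_interpolate_at_node f (Set.injOn_id _) hx
  have h1 : cfc f A = Polynomial.aeval A q := by
    rw [← cfc_polynomial q A hA]
    exact cfc_congr fun x hx => (hqf x (by simp [hs, hx])).symm
  have h2 : ∀ p : Polynomial ℝ, Polynomial.aeval A p v = ((p.eval a : ℝ) : ℂ) • v := by
    intro p
    induction p using Polynomial.induction_on' with
    | add p r hp hr => simp [hp, hr, add_smul]
    | monomial n c =>
      have h3 : ∀ n : ℕ, (A ^ n) v = ((a : ℂ) ^ n) • v := by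
        intro n
        induction n with
        | zero => simp
        | succ n ih =>
          rw [pow_succ, mul_apply_eq_comp, hv, map_smul, ih, smul_smul, pow_succ,
            mul_comm]
      rw [Polynomial.aeval_monomial, mul_apply_eq_comp, h3,
        ContinuousLinearMap.algebraMap_apply, Polynomial.eval_monomial, Complex.ofReal_mul,
        Complex.ofReal_pow, mul_smul]
      simp
  rw [h1, h2, hqf a (by simp [hs])]

theorem exists_eigenbasis {A : H →L[ℂ] H} (hA : 0 ≤ A) :
    ∃ (b : OrthonormalBasis (Fin (Module.finrank ℂ H)) ℂ H)
      (a : Fin (Module.finrank ℂ H) → ℝ), (∀ i, 0 ≤ a i) ∧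
      (∀ i, A (b i) = (a i : ℂ) • b i) ∧ ∀ (f : ℝ → ℝ) i, cfc f A (b i) = (f (a i) : ℂ) • b i := by
  have hp := (ContinuousLinearMap.nonneg_iff_isPositive A).1 hA
  have hs := hp.isSymmetric
  have he : ∀ i, A (hs.eigenvectorBasis rfl i)
      = (hs.eigenvalues rfl i : ℂ) • hs.eigenvectorBasis rfl i :=
    fun i => hs.apply_eigenvectorBasis rfl i
  refine ⟨hs.eigenvectorBasis rfl, hs.eigenvalues rfl, fun i => ?_, he, fun f i =>
    cfc_apply_eigenvector hA.isSelfAdjoint (he i) f⟩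
  have h := hp.re_inner_nonneg_right (hs.eigenvectorBasis rfl i)
  rw [he, inner_smul_right, inner_self_eq_norm_sq_to_K] at h
  simpa using h

theorem re_inner_cfc_eq_sum {ι : Type*} [Fintype ι] {A : H →L[ℂ] H} (f : ℝ → ℝ)
    (e : OrthonormalBasis ι ℂ H) (a : ι → ℝ) (he : ∀ i, cfc f A (e i) = (f (a i) : ℂ) • e i)
    (x : H) : (⟪x, cfc f A x⟫_ℂ).re = ∑ i, f (a i) * ‖⟪e i, x⟫_ℂ‖ ^ 2 := by
  have hsa : ∀ i, ⟪e i, cfc f A x⟫_ℂ = (f (a i) : ℂ) * ⟪e i, x⟫_ℂ := by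
    intro i
    rw [← star_cfc_real A f, ContinuousLinearMap.star_eq_adjoint,
      ContinuousLinearMap.adjoint_inner_right, he, inner_smul_left, Complex.conj_ofReal]
  rw [← e.sum_inner_mul_inner, Complex.re_sum]
  refine Finset.sum_congr rfl fun i _ => ?_
  rw [hsa, mul_left_comm, ← inner_conj_symm x (e i), Complex.conj_mul', ← Complex.ofReal_pow,
    ← Complex.ofReal_mul, Complex.ofReal_re]

/-- The expansion of `Tr f(A) U g(B) U*` in eigenbases of `A` and `B`. -/
theorem exists_tr_cfc_eq_sum {A B : H →L[ℂ] H} (hA : 0 ≤ A) (hB : 0 ≤ B) (U : H →L[ℂ] H) :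
    ∃ (a b : Fin (Module.finrank ℂ H) → ℝ)
      (w : Fin (Module.finrank ℂ H) → Fin (Module.finrank ℂ H) → ℝ),
      (∀ i, 0 ≤ a i) ∧ (∀ i, 0 ≤ b i) ∧ (∀ i j, 0 ≤ w i j) ∧
      ∀ f g : ℝ → ℝ, tr (cfc f A * (U * cfc g B * star U)) =
        ∑ j, ∑ i, f (a i) * g (b j) * w i j := by
  obtain ⟨e, a, ha, -, hea⟩ := exists_eigenbasis hA
  obtain ⟨d, b, hb, -, hdb⟩ := exists_eigenbasis hB
  refine ⟨a, b, fun i j => ‖⟪e i, U (d j)⟫_ℂ‖ ^ 2, ha, hb, fun i j => by positivity,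
    fun f g => ?_⟩
  have : tr (cfc f A * (U * cfc g B * star U)) = tr (star U * cfc f A * U * cfc g B) := by
    rw [← mul_assoc, tr_mul_comm]
    simp only [mul_assoc]
  rw [this, tr_eq_sum d]
  refine Finset.sum_congr rfl fun j _ => ?_
  rw [mul_apply_eq_comp, hdb, map_smul, inner_smul_right, Complex.re_ofReal_mul,
    mul_apply_eq_comp, mul_apply_eq_comp,
    ContinuousLinearMap.star_eq_adjoint, ContinuousLinearMap.adjoint_inner_right,
    re_inner_cfc_eq_sum f e a (hea f), Finset.mul_sum]
  exact Finset.sum_congr rfl fun i _ => by ring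

end FunctionalCalculus

/-! ### Powers on the support. -/

section Powers

variable {H : Type*} [NormedAddCommGroup H] [InnerProductSpace ℂ H] [CompleteSpace H]

theorem psdPow_nonneg {A : H →L[ℂ] H} (hA : 0 ≤ A) (s : ℝ) : 0 ≤ psdPow A s := by
  refine cfc_nonneg fun x hx => ?_
  have := spectrum_nonneg_of_nonneg hA hx
  split_ifs
  · exact le_rfl
  · positivity

theorem psdPow_one {A : H →L[ℂ] H} (hA : 0 ≤ A) : psdPow A 1 = A := by
  rw [psdPow]
  conv_rhs => rw [← cfc_id ℝ A hA.isSelfAdjoint]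
  refine cfc_congr fun x _ => ?_
  by_cases h : x = 0 <;> simp [h]

variable [FiniteDimensional ℂ H]

theorem star_psdPow (A : H →L[ℂ] H) (s : ℝ) : star (psdPow A s) = psdPow A s :=
  star_cfc_real A _

/-- The exponent law needs no restriction on signs: at the eigenvalue `0` both sides vanish by
convention. -/
theorem psdPow_mul {A : H →L[ℂ] H} (hA : 0 ≤ A) (s t : ℝ) :
    psdPow A s * psdPow A t = psdPow A (s + t) := by
  rw [psdPow, psdPow, cfc_mul_cfc]
  refine cfc_congr fun x hx => ?_
  have := spectrum_nonneg_of_nonneg hA hx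
  by_cases h : x = 0
  · simp [h]
  · simp [h, Real.rpow_add (lt_of_le_of_ne this (Ne.symm h))]

theorem psdPow_half_mul_self {A : H →L[ℂ] H} (hA : 0 ≤ A) :
    psdPow A (1 / 2) * psdPow A (1 / 2) = A := by
  rw [psdPow_mul hA, add_halves, psdPow_one hA]

theorem psdPow_zero_of_isUnit {A : H →L[ℂ] H} (hA : IsSelfAdjoint A) (hu : IsUnit A) :
    psdPow A 0 = 1 := by
  rw [psdPow, ← cfc_one ℝ A hA]
  refine cfc_congr fun x hx => ?_
  have : x ≠ 0 := by
    rintro rfl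
    exact spectrum.zero_notMem ℝ hu hx
  simp [this]

theorem psdPow_smul {A : H →L[ℂ] H} (hA : 0 ≤ A) {c : ℝ} (hc : 0 < c) (s : ℝ) :
    psdPow (c • A) s = c ^ s • psdPow A s := by
  rw [psdPow, psdPow, ← cfc_comp_const_mul c _ A
    (((finite_spectrum_real A).image _).continuousOn _) hA.isSelfAdjoint,
    ← cfc_const_mul _ _ A (continuousOn_spectrum A _)]
  refine cfc_congr fun x hx => ?_
  have := spectrum_nonneg_of_nonneg hA hx
  by_cases h : x = 0
  · simp [h]
  · simp [h, hc.ne', Real.mul_rpow hc.le this]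

theorem psdPow_of_isIdempotentElem {P : H →L[ℂ] H} (hP : IsSelfAdjoint P)
    (hi : IsIdempotentElem P) (s : ℝ) : psdPow P s = P := by
  rw [psdPow]
  conv_rhs => rw [← cfc_id ℝ P hP]
  refine cfc_congr fun x hx => ?_
  have := hi.spectrum_subset ℝ hx
  rcases this with rfl | h
  · simp
  · rw [Set.mem_singleton_iff] at h
    simp [h]

end Powers

/-! ### Polar decomposition, trace norm and the trace Young inequality. -/

section TraceNorm

variable {H : Type*} [NormedAddCommGroup H] [InnerProductSpace ℂ H] [CompleteSpace H]

theorem le_one_of_isIdempotentElem {P : H →L[ℂ] H} (hs : star P = P) (hi : P * P = P) :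
    P ≤ 1 := by
  have h : (1 - P) = star (1 - P) * (1 - P) := by
    rw [star_sub, star_one, hs, sub_mul, mul_sub, mul_sub, hi]
    simp
  rw [← sub_nonneg, h]
  exact star_mul_self_nonneg _

variable [FiniteDimensional ℂ H]

/-- A partial isometry `U` with `U* X = |X|`. -/
theorem exists_star_mul_eq_abs (X : H →L[ℂ] H) :
    ∃ U : H →L[ℂ] H, star U * U ≤ 1 ∧ U * star U ≤ 1 ∧ star U * X = CFC.abs X := by
  set P := CFC.abs X with hP
  have hPs : IsSelfAdjoint P := (CFC.abs_nonneg X).isSelfAdjoint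
  have hPP : P * P = star X * X := CFC.abs_mul_abs X
  have hid : cfc (fun x : ℝ => x) P = P := cfc_id' ℝ P hPs
  -- Since `0⁻¹ = 0`, this is the pseudo-inverse of `|X|`. The partial isometry is then `X * K`, and
  -- `K * P` is the support projection of `|X|`.
  set K := cfc (fun x : ℝ => x⁻¹) P with hK
  have hKs : star K = K := star_cfc_real P _
  have hKP : K * P = P * K := by
    have : K * cfc (fun x : ℝ => x) P = cfc (fun x : ℝ => x) P * K := by
      rw [cfc_mul_cfc, cfc_mul_cfc]
      exact cfc_congr fun x _ => mul_comm _ _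
    rwa [hid] at this
  have hKPP : K * (P * P) = P := by
    have : K * (cfc (fun x : ℝ => x) P * cfc (fun x : ℝ => x) P) = cfc (fun x : ℝ => x) P := by
      rw [cfc_mul_cfc, cfc_mul_cfc]
      refine cfc_congr fun x _ => ?_
      by_cases h : x = 0
      · simp [h]
      · field_simp
    rwa [hid] at this
  have hKKP : K * (K * P) = K := by
    have : K * (K * cfc (fun x : ℝ => x) P) = K := by
      rw [cfc_mul_cfc, cfc_mul_cfc]
      refine cfc_congr fun x _ => ?_
      by_cases h : x = 0
      · simp [h]
      · field_simp
    rwa [hid] at this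
  have hUU : star (X * K) * (X * K) = K * P := by
    rw [star_mul, hKs, mul_assoc, ← mul_assoc (star X), ← hPP, ← mul_assoc, hKPP, hKP]
  refine ⟨X * K, ?_, ?_, ?_⟩
  · refine le_one_of_isIdempotentElem (by simp) ?_
    rw [hUU, mul_assoc, ← mul_assoc P, ← hKP, mul_assoc, hKPP]
  · refine le_one_of_isIdempotentElem (by simp) ?_
    calc X * K * star (X * K) * (X * K * star (X * K))
        = X * K * (star (X * K) * (X * K)) * star (X * K) := by simp only [mul_assoc]
      _ = X * (K * (K * P)) * star (X * K) := by rw [hUU]; simp only [mul_assoc]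
      _ = _ := by rw [hKKP]
  · rw [star_mul, hKs, mul_assoc, ← hPP, hKPP]

/-- In an eigenbasis `b` of `|X|`, `‖X (b i)‖` is the `i`-th eigenvalue of `|X|` and dominates the
real part of the `i`-th diagonal entry of `X`. -/
theorem tr_le_traceNorm (X : H →L[ℂ] H) : tr X ≤ traceNorm X := by
  obtain ⟨b, a, ha, hab, -⟩ := exists_eigenbasis (CFC.abs_nonneg X)
  rw [traceNorm, tr_eq_sum b, tr_eq_sum b]
  refine Finset.sum_le_sum fun i _ => ?_
  have hPP : CFC.abs X * CFC.abs X = star X * X := CFC.abs_mul_abs X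
  have hn : ‖X (b i)‖ ^ 2 = a i ^ 2 := by
    have h1 : ⟪b i, (star X * X) (b i)⟫_ℂ = ((a i ^ 2 : ℝ) : ℂ) := by
      rw [← hPP, mul_apply_eq_comp, hab, map_smul, hab, inner_smul_right, inner_smul_right,
        inner_self_eq_norm_sq_to_K]
      simp [sq]
    rw [mul_apply_eq_comp, ContinuousLinearMap.star_eq_adjoint,
      ContinuousLinearMap.adjoint_inner_right, inner_self_eq_norm_sq_to_K] at h1
    exact Complex.ofReal_injective (by simpa using h1)
  have hn' : ‖X (b i)‖ = a i := (sq_eq_sq₀ (norm_nonneg _) (ha i)).1 hn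
  have h2 : ⟪b i, CFC.abs X (b i)⟫_ℂ = (a i : ℂ) := by
    rw [hab, inner_smul_right, inner_self_eq_norm_sq_to_K]
    simp
  rw [h2, Complex.ofReal_re, ← hn']
  simpa using re_inner_le_norm (𝕜 := ℂ) (b i) (X (b i))

/-- A Young inequality for traces: `Tr A^s U B^{1-s} U* ≤ s Tr A + (1-s) Tr B` for contractions
`U`. -/
theorem tr_psdPow_mul_conj_le {A B U : H →L[ℂ] H} (hA : 0 ≤ A) (hB : 0 ≤ B)
    (hU : star U * U ≤ 1) (hU' : U * star U ≤ 1) {s : ℝ} (hs : s ∈ Set.Icc (0 : ℝ) 1) :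
    tr (psdPow A s * (U * psdPow B (1 - s) * star U)) ≤ s * tr A + (1 - s) * tr B := by
  obtain ⟨a, b, w, ha, hb, hw, h⟩ := exists_tr_cfc_eq_sum hA hB U
  -- These two choices identify the weighted sums of `a i` and of `b j` as `Tr A U U*` and `Tr B U*
  -- U`, which the contraction hypotheses bound.
  have h1 := h (fun x => x) (fun _ => 1)
  have h2 := h (fun _ => 1) (fun x => x)
  rw [cfc_id' ℝ A hA.isSelfAdjoint, cfc_const_one ℝ B hB.isSelfAdjoint, mul_one] at h1
  rw [cfc_id' ℝ B hB.isSelfAdjoint, cfc_const_one ℝ A hA.isSelfAdjoint, one_mul,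
    mul_assoc, tr_mul_comm, mul_assoc] at h2
  have h3 := tr_mul_le_tr hA hU'
  have h4 := tr_mul_le_tr hB hU
  calc tr (psdPow A s * (U * psdPow B (1 - s) * star U))
      ≤ ∑ j, ∑ i, (s * (a i * 1 * w i j) + (1 - s) * (1 * b j * w i j)) := by
        rw [psdPow, psdPow, h]
        refine Finset.sum_le_sum fun j _ => Finset.sum_le_sum fun i _ => ?_
        -- Weighted AM–GM; when an eigenvalue is `0` the left side is `0`, even at `s = 0` or `s =
        -- 1`.
        have hy : (if a i = 0 then 0 else a i ^ s) * (if b j = 0 then 0 else b j ^ (1 - s))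
            ≤ s * a i + (1 - s) * b j := by
          have hs0 := hs.1
          have hs1 : 0 ≤ 1 - s := sub_nonneg.2 hs.2
          have hai := ha i
          have hbj := hb j
          split_ifs
          · simp only [mul_zero]; positivity
          · simp only [zero_mul]; positivity
          · simp only [mul_zero]; positivity
          · exact Real.geom_mean_le_arith_mean2_weighted hs0 hs1 hai hbj (by ring)
        nlinarith [mul_le_mul_of_nonneg_right hy (hw i j)]
    _ = s * tr (A * (U * star U)) + (1 - s) * tr (B * (star U * U)) := by
        simp only [Finset.sum_add_distrib, ← Finset.mul_sum, h1, h2]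
    _ ≤ s * tr A + (1 - s) * tr B := by
        have hs0 := hs.1
        have hs1 : 0 ≤ 1 - s := sub_nonneg.2 hs.2
        gcongr

end TraceNorm

/-! ### Fidelity against Chernoff quantities and binary error. -/

section Fidelity

variable {H : Type*} [NormedAddCommGroup H] [InnerProductSpace ℂ H] [CompleteSpace H]
  [FiniteDimensional ℂ H]

theorem sq_fidelity_le_chernoffQ {A B : H →L[ℂ] H} (hA : 0 ≤ A) (hB : 0 ≤ B) (hA1 : tr A ≤ 1)
    (hB1 : tr B ≤ 1) {s : ℝ} (hs : s ∈ Set.Icc (0 : ℝ) 1) :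
    fidelity A B ^ 2 ≤ chernoffQ s A B := by
  obtain ⟨U, hU, hU', hX⟩ := exists_star_mul_eq_abs (psdPow A (1 / 2) * psdPow B (1 / 2))
  set a₁ := psdPow A ((1 - s) / 2)
  set a₂ := psdPow A (s / 2)
  set b₁ := psdPow B ((1 - s) / 2)
  set b₂ := psdPow B (s / 2)
  have ha : psdPow A (1 / 2) = a₁ * a₂ := by
    rw [psdPow_mul hA]; congr 1; ring
  have hb : psdPow B (1 / 2) = b₁ * b₂ := by
    rw [psdPow_mul hB]; congr 1; ring
  have ha₁ : a₁ * a₁ = psdPow A (1 - s) := by rw [psdPow_mul hA, add_halves]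
  have ha₂ : a₂ * a₂ = psdPow A s := by rw [psdPow_mul hA, add_halves]
  have hb₁ : b₁ * b₁ = psdPow B (1 - s) := by rw [psdPow_mul hB, add_halves]
  have hb₂ : b₂ * b₂ = psdPow B s := by rw [psdPow_mul hB, add_halves]
  have hsa₁ : star a₁ = a₁ := star_psdPow A _
  have hsa₂ : star a₂ = a₂ := star_psdPow A _
  have hsb₁ : star b₁ = b₁ := star_psdPow B _
  have hsb₂ : star b₂ = b₂ := star_psdPow B _
  -- Powers of the same operator commute, so `B^{1/2}` is split with `b₂` last; cyclicity then
  -- carries `b₂` to the front.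
  have hF : fidelity A B = tr (star (a₁ * U * b₂) * (a₂ * b₁)) := by
    rw [fidelity, traceNorm, ← hX, ha, hb, ← mul_assoc, ← mul_assoc, tr_mul_comm]
    simp only [star_mul, hsa₁, hsb₂, mul_assoc]
  -- This factor is `Tr A^{1-s} U B^s U*`, so the Young inequality applies with exponent `1 - s`.
  have h1 : tr (star (a₁ * U * b₂) * (a₁ * U * b₂)) ≤ 1 := by
    have he : tr (star (a₁ * U * b₂) * (a₁ * U * b₂))
        = tr (psdPow A (1 - s) * (U * psdPow B (1 - (1 - s)) * star U)) := by
      rw [sub_sub_cancel, ← ha₁, ← hb₂, tr_mul_comm, mul_assoc a₁ a₁, tr_mul_comm a₁]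
      simp only [star_mul, hsa₁, hsb₂, mul_assoc]
    rw [he]
    refine (tr_psdPow_mul_conj_le hA hB hU hU' ⟨by linarith [hs.2], by linarith [hs.1]⟩).trans ?_
    nlinarith [hs.1, hs.2]
  have h2 : tr (star (a₂ * b₁) * (a₂ * b₁)) = chernoffQ s A B := by
    rw [chernoffQ, ← ha₂, ← hb₁, tr_mul_comm, mul_assoc a₂ a₂, tr_mul_comm a₂]
    simp only [star_mul, hsa₂, hsb₁, mul_assoc]
  calc fidelity A B ^ 2
      ≤ tr (star (a₁ * U * b₂) * (a₁ * U * b₂)) * tr (star (a₂ * b₁) * (a₂ * b₁)) := by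
        rw [hF]; exact sq_tr_star_mul_le _ _
    _ ≤ 1 * chernoffQ s A B := by
        rw [h2]
        refine mul_le_mul_of_nonneg_right h1 ?_
        rw [← h2]
        exact tr_star_mul_self_nonneg _
    _ = _ := one_mul _

theorem fidelity_smul {A B : H →L[ℂ] H} (hA : 0 ≤ A) (hB : 0 ≤ B) {p q : ℝ} (hp : 0 < p)
    (hq : 0 < q) : fidelity (p • A) (q • B) = √(p * q) * fidelity A B := by
  rw [fidelity, fidelity, traceNorm, traceNorm, psdPow_smul hA hp, psdPow_smul hB hq,
    smul_mul_smul_comm, ← tr_smul, Real.sqrt_mul hp.le, Real.sqrt_eq_rpow, Real.sqrt_eq_rpow]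
  congr 1
  have h : 0 ≤ p ^ (1 / 2 : ℝ) * q ^ (1 / 2 : ℝ) := by positivity
  have := CFC.abs_smul (p ^ (1 / 2 : ℝ) * q ^ (1 / 2 : ℝ))
    (psdPow A (1 / 2) * psdPow B (1 / 2))
  rwa [Real.norm_of_nonneg h] at this

theorem sq_fidelity_le_chernoffQmin {A B : H →L[ℂ] H} (hA : 0 ≤ A) (hB : 0 ≤ B)
    (hA1 : tr A ≤ 1) (hB1 : tr B ≤ 1) : fidelity A B ^ 2 ≤ chernoffQmin A B := by
  refine le_csInf ⟨_, 0, by simp, rfl⟩ ?_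
  rintro _ ⟨s, hs, rfl⟩
  exact sq_fidelity_le_chernoffQ hA hB hA1 hB1 hs

/-- Splitting by `E 0` and `1 - E 0` writes the fidelity as `x + y`, and Cauchy–Schwarz bounds `x²`
and `y²` by products of outcome probabilities. In each product one factor is an error term of the
test `(E 0, 1 - E 0)`, which errs no more than `E`. -/
theorem sq_fidelity_le_mul_errorProb {A : Fin 2 → H →L[ℂ] H} (hA : ∀ i, 0 ≤ A i)
    {E : Fin 2 → H →L[ℂ] H} (hE : IsPOVM E) :
    fidelity (A 0) (A 1) ^ 2 ≤ (tr (A 0) + tr (A 1)) * errorProb A E := by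
  obtain ⟨U, hU, hU', hX⟩ := exists_star_mul_eq_abs (psdPow (A 0) (1 / 2) * psdPow (A 1) (1 / 2))
  have hE0 : 0 ≤ E 0 := (ContinuousLinearMap.nonneg_iff_isPositive _).2 (hE.isPositive 0)
  have hE1 : 0 ≤ E 1 := (ContinuousLinearMap.nonneg_iff_isPositive _).2 (hE.isPositive 1)
  have hsum : E 0 + E 1 ≤ 1 := by simpa using hE.sum_le_one
  set a := psdPow (A 0) (1 / 2)
  set b := psdPow (A 1) (1 / 2)
  have haa : a * a = A 0 := psdPow_half_mul_self (hA 0)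
  have hbb : b * b = A 1 := psdPow_half_mul_self (hA 1)
  have hsa : star a = a := star_psdPow _ _
  have hsb : star b = b := star_psdPow _ _
  have key : ∀ G : H →L[ℂ] H, 0 ≤ G →
      tr (star U * a * G * b) ^ 2 ≤ tr (A 0 * G) * tr (A 1 * G) := by
    intro G hG
    set g := psdPow G (1 / 2)
    have hgg : g * g = G := psdPow_half_mul_self hG
    have hsg : star g = g := star_psdPow _ _
    have h1 : tr (star U * a * G * b) = tr (star (g * a * U) * (g * b)) := by
      rw [← hgg]; simp only [star_mul, hsg, hsa, mul_assoc]
    have h2 : tr (star (g * a * U) * (g * a * U)) ≤ tr (A 0 * G) := by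
      have e1 : tr (star (g * a * U) * (g * a * U)) = tr (a * G * a * (U * star U)) := by
        rw [← hgg, ← mul_assoc _ U, tr_mul_comm _ (star U)]
        simp only [star_mul, hsg, hsa, mul_assoc]
      have e2 : tr (A 0 * G) = tr (a * G * a) := by
        rw [← haa, tr_mul_comm (a * G), mul_assoc]
      rw [e1, e2]
      refine tr_mul_le_tr ?_ hU'
      simpa [hsa] using star_left_conjugate_nonneg hG a
    have h3 : tr (star (g * b) * (g * b)) = tr (A 1 * G) := by
      rw [← hgg, ← hbb, mul_assoc b b, tr_mul_comm b]
      simp only [star_mul, hsg, hsb, mul_assoc]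
    rw [h1]
    refine (sq_tr_star_mul_le _ _).trans ?_
    rw [h3]
    exact mul_le_mul_of_nonneg_right h2 (tr_mul_nonneg (hA 1) hG)
  have hF : fidelity (A 0) (A 1)
      = tr (star U * a * E 0 * b) + tr (star U * a * (1 - E 0) * b) := by
    rw [fidelity, traceNorm, ← hX, ← tr_add, ← add_mul, ← mul_add]
    simp [mul_assoc]
  have hE0' : 0 ≤ 1 - E 0 := sub_nonneg.2 ((le_add_of_nonneg_right hE1).trans hsum)
  have k1 := key _ hE0
  have k2 := key _ hE0'
  have p1 := tr_mul_nonneg (hA 0) hE0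
  have p2 := tr_mul_nonneg (hA 0) hE0'
  have p3 := tr_mul_nonneg (hA 1) hE0
  have p4 := tr_mul_nonneg (hA 1) hE0'
  have q0 : tr (A 0) = tr (A 0 * E 0) + tr (A 0 * (1 - E 0)) := by
    rw [← tr_add, ← mul_add]; simp
  have q1 : tr (A 1) = tr (A 1 * E 0) + tr (A 1 * (1 - E 0)) := by
    rw [← tr_add, ← mul_add]; simp
  have hle : tr (A 1 * E 0) ≤ tr (A 1 * (1 - E 1)) :=
    tr_mul_le_tr_mul (hA 1) (le_sub_iff_add_le.2 hsum)
  rw [errorProb, Fin.sum_univ_two, hF]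
  refine le_trans (b := (tr (A 0) + tr (A 1)) * (tr (A 0 * (1 - E 0)) + tr (A 1 * E 0))) ?_ ?_
  · rw [q0, q1]
    set x := tr (star U * a * E 0 * b)
    set y := tr (star U * a * (1 - E 0) * b)
    set α := tr (A 0 * E 0)
    set β := tr (A 0 * (1 - E 0))
    set γ := tr (A 1 * E 0)
    set δ := tr (A 1 * (1 - E 0))
    -- With `x² ≤ αγ` and `y² ≤ βδ`, this AM–GM bound gives `(x + y)² ≤ (α + δ)(β + γ)`, where `β +
    -- γ` is the error.
    have hxy : 2 * (x * y) ≤ α * β + γ * δ := by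
      refine le_of_sq_le_sq ?_ (by positivity)
      calc (2 * (x * y)) ^ 2 = 4 * (x ^ 2 * y ^ 2) := by ring
        _ ≤ 4 * ((α * γ) * (β * δ)) := by gcongr
        _ ≤ (α * β + γ * δ) ^ 2 := by nlinarith [sq_nonneg (α * β - γ * δ)]
    nlinarith [mul_nonneg p1 p2, mul_nonneg p3 p4, mul_nonneg p2 p4, mul_nonneg p1 p3]
  · refine mul_le_mul_of_nonneg_left (by linarith) (by linarith)

theorem sq_fidelity_le_mul_optError {A B : H →L[ℂ] H} (hA : 0 ≤ A) (hB : 0 ≤ B) :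
    fidelity A B ^ 2 ≤ (tr A + tr B) * optError ![A, B] := by
  have h : ∀ E : Fin 2 → H →L[ℂ] H, IsPOVM E →
      fidelity A B ^ 2 ≤ (tr A + tr B) * errorProb ![A, B] E := fun E hE => by
    have := sq_fidelity_le_mul_errorProb (A := ![A, B]) (by simp [Fin.forall_fin_two, hA, hB]) hE
    simpa using this
  have h0 : IsPOVM (0 : Fin 2 → H →L[ℂ] H) :=
    ⟨fun i => ContinuousLinearMap.isPositive_zero, by simp⟩
  have ht : 0 ≤ tr A + tr B := add_nonneg (tr_nonneg hA) (tr_nonneg hB)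
  -- Passing to the infimum requires dividing by the total trace; if that is zero, any single POVM
  -- already forces zero fidelity.
  rcases ht.eq_or_lt with ht | ht
  · have := h 0 h0
    rw [← ht, zero_mul] at this ⊢
    exact this
  · rw [← div_le_iff₀' ht]
    refine le_csInf ⟨_, 0, h0, rfl⟩ ?_
    rintro _ ⟨E, hE, rfl⟩
    rw [div_le_iff₀' ht]
    exact h E hE

end Fidelity

/-! ### The square-root measurement for several hypotheses. -/

section MultipleHypotheses

variable {H : Type*} [NormedAddCommGroup H] [InnerProductSpace ℂ H] [CompleteSpace H]
  [FiniteDimensional ℂ H]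

theorem optError_le_errorProb {r : ℕ} {A E : Fin r → H →L[ℂ] H} (hA : ∀ i, 0 ≤ A i)
    (hE : IsPOVM E) : optError A ≤ errorProb A E := by
  refine csInf_le ⟨0, ?_⟩ ⟨E, hE, rfl⟩
  rintro _ ⟨F, hF, rfl⟩
  refine Finset.sum_nonneg fun i _ => tr_mul_nonneg (hA i) (sub_nonneg.2 ?_)
  exact (Finset.single_le_sum (f := F)
    (fun j _ => (ContinuousLinearMap.nonneg_iff_isPositive _).2 (hF.isPositive j))
    (Finset.mem_univ i)).trans hF.sum_le_one

/-- With `e = A^{1/8}`, `n = S^{-1/4}` and `m = S^{1/4}`, this bounds the error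
`Tr A (1 - S^{-1/2} A^{1/2} S^{-1/2})` by `Tr S A^{1/2} - Tr A`. -/
theorem two_mul_tr_pow_le {e n m : H →L[ℂ] H} (he : star e = e) (hn : star n = n)
    (hm : star m = m) (hnm : n * m = 1) (hmn : m * n = 1) :
    2 * tr (e ^ 8) ≤ tr (m ^ 4 * e ^ 4) + tr (e ^ 8 * (n ^ 2 * e ^ 4 * n ^ 2)) := by
  have cyc : ∀ (X : H →L[ℂ] H) (i j : ℕ), tr (e ^ i * X * e ^ j) = tr (e ^ (j + i) * X) := by
    intro X i j
    rw [tr_mul_comm, ← mul_assoc, ← pow_add]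
  have h1 := tr_star_mul_self_nonneg (e ^ 2 * n ^ 2 * e ^ 4 - e ^ 4)
  have h2 := tr_star_mul_self_nonneg (m ^ 2 * e ^ 2 - e ^ 4)
  have h3 := tr_star_mul_self_nonneg (m * e ^ 3 - n * e ^ 5)
  have e1 : star (e ^ 2 * n ^ 2 * e ^ 4 - e ^ 4) * (e ^ 2 * n ^ 2 * e ^ 4 - e ^ 4)
      = e ^ 4 * (n ^ 2 * e ^ 4 * n ^ 2) * e ^ 4 - e ^ 4 * n ^ 2 * e ^ 6 - e ^ 6 * n ^ 2 * e ^ 4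
        + e ^ 8 := by
    simp only [star_sub, star_mul, star_pow, he, hn]
    noncomm_ring
  have e2 : star (m ^ 2 * e ^ 2 - e ^ 4) * (m ^ 2 * e ^ 2 - e ^ 4)
      = e ^ 2 * m ^ 4 * e ^ 2 - e ^ 2 * m ^ 2 * e ^ 4 - e ^ 4 * m ^ 2 * e ^ 2 + e ^ 8 := by
    simp only [star_sub, star_mul, star_pow, he, hm]
    noncomm_ring
  have e3 : star (m * e ^ 3 - n * e ^ 5) * (m * e ^ 3 - n * e ^ 5)
      = e ^ 3 * m ^ 2 * e ^ 3 - e ^ 8 - e ^ 8 + e ^ 5 * n ^ 2 * e ^ 5 := by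
    have : star (m * e ^ 3 - n * e ^ 5) * (m * e ^ 3 - n * e ^ 5)
      = e ^ 3 * m ^ 2 * e ^ 3 - e ^ 3 * (m * n) * e ^ 5 - e ^ 5 * (n * m) * e ^ 3
        + e ^ 5 * n ^ 2 * e ^ 5 := by
      simp only [star_sub, star_mul, star_pow, he, hm, hn]
      noncomm_ring
    rw [this, hmn, hnm, mul_one, mul_one, ← pow_add, ← pow_add]
  rw [e1, tr_add, tr_sub, tr_sub, cyc, cyc, cyc] at h1
  rw [e2, tr_add, tr_sub, tr_sub, cyc, cyc, cyc] at h2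
  rw [e3, tr_add, tr_sub, tr_sub, cyc, cyc] at h3
  rw [tr_mul_comm (m ^ 4)]
  norm_num at h1 h2 h3
  -- The combination is `h1 + h2 + 2 * h3`: the mixed terms `Tr e^10 n^2` and `Tr e^6 m^2` cancel.
  linarith

theorem exists_fourth_root {S : H →L[ℂ] H} (hS : 0 ≤ S) (hu : IsUnit S) :
    ∃ n m : H →L[ℂ] H, star n = n ∧ star m = m ∧ n * m = 1 ∧ m * n = 1 ∧ m ^ 4 = S := by
  have hone : psdPow S 0 = 1 := psdPow_zero_of_isUnit hS.isSelfAdjoint hu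
  refine ⟨psdPow S (-(1 / 4)), psdPow S (1 / 4), star_psdPow _ _, star_psdPow _ _, ?_, ?_, ?_⟩
  · rw [psdPow_mul hS, ← hone]; norm_num
  · rw [psdPow_mul hS, ← hone]; norm_num
  · simp only [pow_succ, pow_zero, one_mul, psdPow_mul hS]
    norm_num [psdPow_one hS]

theorem isPOVM_conj {r : ℕ} {B : Fin r → H →L[ℂ] H} (hB : ∀ i, 0 ≤ B i) {N S : H →L[ℂ] H}
    (hN : star N = N) (hS : ∑ i, B i ≤ S) (hNS : N * S * N = 1) :
    IsPOVM fun i => N * B i * N := by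
  refine ⟨fun i => ?_, ?_⟩
  · rw [← ContinuousLinearMap.nonneg_iff_isPositive]
    have := star_left_conjugate_nonneg (hB i) N
    rwa [hN] at this
  · have h := star_left_conjugate_le_conjugate hS N
    rwa [hN, hNS, Finset.mul_sum, Finset.sum_mul] at h

theorem optError_le_add {r : ℕ} {A : Fin r → H →L[ℂ] H} (hA : ∀ i, 0 ≤ A i) {ε : ℝ}
    (hε : 0 < ε) :
    optError A ≤ ∑ q ∈ (Finset.univ : Finset (Fin r)).offDiag,
      tr (psdPow (A q.1) (1 / 2) * psdPow (A q.2) (1 / 2))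
      + ε * ∑ i, tr (psdPow (A i) (1 / 2)) := by
  obtain ⟨B, hB⟩ : ∃ B : Fin r → H →L[ℂ] H, ∀ i, B i = psdPow (A i) (1 / 2) := ⟨_, fun _ => rfl⟩
  have hB0 : ∀ i, 0 ≤ B i := fun i => hB i ▸ psdPow_nonneg (hA i) _
  have hsumB : 0 ≤ ∑ i, B i := Finset.sum_nonneg fun i _ => hB0 i
  -- The `ε` shift makes `S` invertible even if the `A i` have a common kernel.
  obtain ⟨S, hS⟩ : ∃ S : H →L[ℂ] H, S = ∑ i, B i + ε • 1 := ⟨_, rfl⟩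
  have hBS : ∑ i, B i ≤ S := hS ▸ le_add_of_nonneg_right (smul_nonneg hε.le zero_le_one)
  have hSu : IsUnit S :=
    CStarAlgebra.isUnit_of_le (ε • (1 : H →L[ℂ] H)) (hS ▸ le_add_of_nonneg_left hsumB)
      (IsStrictlyPositive.smul hε isStrictlyPositive_one)
  obtain ⟨n, m, hsn, hsm, hnm, hmn, hm4⟩ := exists_fourth_root (hsumB.trans hBS) hSu
  have hnSn : n ^ 2 * S * n ^ 2 = 1 := by
    have : n ^ 2 * m ^ 4 * n ^ 2 = n * (n * m) * m * (m * (m * n) * n) := by noncomm_ring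
    rw [← hm4, this, hnm, hmn, mul_one, mul_one, hnm, hmn, one_mul]
  refine (optError_le_errorProb hA (isPOVM_conj hB0 (by rw [star_pow, hsn]) hBS hnSn)).trans ?_
  have hBB : ∀ i, B i * B i = A i := fun i => by rw [hB, psdPow_half_mul_self (hA i)]
  have hk : ∀ i, tr (A i * (1 - n ^ 2 * B i * n ^ 2)) ≤ tr (S * B i) - tr (B i * B i) := by
    intro i
    -- An eighth root makes all the powers of `A i` in the three squares integer powers of one
    -- element.
    obtain ⟨e, he⟩ : ∃ e, e = psdPow (A i) (1 / 8) := ⟨_, rfl⟩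
    have he4 : e ^ 4 = B i := by
      simp only [pow_succ, pow_zero, one_mul, he, psdPow_mul (hA i), hB]
      norm_num
    have he8 : e ^ 8 = A i := by
      rw [show 8 = 4 + 4 from rfl, pow_add, he4, hBB]
    have := two_mul_tr_pow_le (he ▸ star_psdPow (A i) (1 / 8)) hsn hsm hnm hmn
    rw [he4, he8, hm4] at this
    rw [mul_sub, tr_sub, mul_one, hBB]
    linarith
  refine (Finset.sum_le_sum fun i _ => hk i).trans (le_of_eq ?_)
  have hSB : ∀ i, tr (S * B i) = ∑ j, tr (B i * B j) + ε * tr (B i) := by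
    intro i
    rw [hS, add_mul, tr_add, Finset.sum_mul, tr_sum, smul_mul_assoc, one_mul, tr_smul]
    simp only [tr_mul_comm (B i)]
  have hoff : ∑ i, ∑ j, tr (B i * B j)
      = ∑ i, tr (B i * B i) + ∑ q ∈ (Finset.univ : Finset (Fin r)).offDiag,
        tr (B q.1 * B q.2) := by
    rw [← Finset.sum_product', ← Finset.diag_union_offDiag,
      Finset.sum_union (Finset.disjoint_diag_offDiag _), Finset.sum_diag]
  simp only [← hB]
  rw [Finset.sum_sub_distrib, Finset.sum_congr rfl fun i _ => hSB i, Finset.sum_add_distrib, hoff,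
    ← Finset.mul_sum]
  ring

theorem optError_le_sum_tr {r : ℕ} {A : Fin r → H →L[ℂ] H} (hA : ∀ i, 0 ≤ A i) :
    optError A ≤ ∑ q ∈ (Finset.univ : Finset (Fin r)).offDiag,
      tr (psdPow (A q.1) (1 / 2) * psdPow (A q.2) (1 / 2)) := by
  set t := ∑ i, tr (psdPow (A i) (1 / 2))
  have ht : 0 ≤ t := Finset.sum_nonneg fun i _ => tr_nonneg (psdPow_nonneg (hA i) _)
  refine le_of_forall_pos_le_add fun δ hδ => ?_
  -- The `+ 1` keeps the denominator positive when `t = 0`.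
  refine (optError_le_add hA (ε := δ / (t + 1)) (by positivity)).trans ?_
  gcongr
  rw [div_mul_eq_mul_div, div_le_iff₀ (by positivity)]
  nlinarith

end MultipleHypotheses

/-! ### Pure states. -/

section PureStates

variable {H : Type*} [NormedAddCommGroup H] [InnerProductSpace ℂ H] [CompleteSpace H]

theorem IsPureState.isIdempotentElem {ρ : H →L[ℂ] H} (h : IsPureState ρ) :
    IsIdempotentElem ρ := by
  obtain ⟨ψ, hψ, rfl⟩ := h
  exact InnerProductSpace.isIdempotentElem_rankOne_self hψ

theorem IsPureState.isPositive {ρ : H →L[ℂ] H} (h : IsPureState ρ) : 0 ≤ ρ := by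
  obtain ⟨ψ, hψ, rfl⟩ := h
  exact (ContinuousLinearMap.nonneg_iff_isPositive _).2
    (InnerProductSpace.isPositive_rankOne_self ψ)

variable [FiniteDimensional ℂ H]

theorem IsPureState.tr_eq_one {ρ : H →L[ℂ] H} (h : IsPureState ρ) : tr ρ = 1 := by
  obtain ⟨ψ, hψ, rfl⟩ := h
  rw [tr, InnerProductSpace.trace_rankOne, inner_self_eq_norm_sq_to_K, hψ]
  simp

theorem IsPureState.psdPow_eq {ρ : H →L[ℂ] H} (h : IsPureState ρ) (s : ℝ) : psdPow ρ s = ρ :=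
  psdPow_of_isIdempotentElem h.isPositive.isSelfAdjoint h.isIdempotentElem s

theorem IsPureState.chernoffQmin_eq {ρ τ : H →L[ℂ] H} (hρ : IsPureState ρ)
    (hτ : IsPureState τ) : chernoffQmin ρ τ = tr (ρ * τ) := by
  have : (fun s : ℝ => chernoffQ s ρ τ) = fun _ => tr (ρ * τ) := by
    funext s
    rw [chernoffQ, hρ.psdPow_eq, hτ.psdPow_eq]
  rw [chernoffQmin, this, Set.Nonempty.image_const ⟨0, by simp⟩, csInf_singleton]

/-- Since `(ρτ)*(ρτ) = τρτ`, this determines `|ρτ|` as a multiple of `τ`, and hence the fidelity. -/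
theorem IsPureState.mul_mul_eq_smul {ρ τ : H →L[ℂ] H} (hρ : IsPureState ρ)
    (hτ : IsPureState τ) : τ * ρ * τ = tr (ρ * τ) • τ := by
  obtain ⟨ψ, hψ, rfl⟩ := hρ
  obtain ⟨φ, hφ, rfl⟩ := hτ
  have h1 : tr (InnerProductSpace.rankOne ℂ ψ ψ * InnerProductSpace.rankOne ℂ φ φ)
      = ‖⟪ψ, φ⟫_ℂ‖ ^ 2 := by
    rw [ContinuousLinearMap.mul_def, InnerProductSpace.rankOne_comp_rankOne, tr,
      ContinuousLinearMap.toLinearMap_smul, map_smul, InnerProductSpace.trace_rankOne,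
      smul_eq_mul, ← inner_conj_symm φ ψ, Complex.mul_conj', ← Complex.ofReal_pow,
      Complex.ofReal_re]
  ext x
  rw [h1]
  simp only [mul_apply_eq_comp, InnerProductSpace.rankOne_apply, map_smul,
    smul_apply, smul_smul]
  rw [← Complex.coe_smul, smul_smul, ← inner_conj_symm φ ψ, Complex.ofReal_pow,
    ← Complex.mul_conj']
  congr 1
  ring

theorem IsPureState.sq_fidelity_eq {ρ τ : H →L[ℂ] H} (hρ : IsPureState ρ)
    (hτ : IsPureState τ) : fidelity ρ τ ^ 2 = tr (ρ * τ) := by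
  have ht : 0 ≤ tr (ρ * τ) := tr_mul_nonneg hρ.isPositive hτ.isPositive
  have habs : CFC.abs (ρ * τ) = √(tr (ρ * τ)) • τ := by
    refine CFC.sqrt_unique ?_ (smul_nonneg (Real.sqrt_nonneg _) hτ.isPositive)
    rw [star_mul, hρ.isPositive.isSelfAdjoint.star_eq, hτ.isPositive.isSelfAdjoint.star_eq,
      smul_mul_smul_comm, Real.mul_self_sqrt ht, hτ.isIdempotentElem.eq, ← mul_assoc,
      mul_assoc τ ρ ρ, hρ.isIdempotentElem.eq, hρ.mul_mul_eq_smul hτ]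
  rw [fidelity, hρ.psdPow_eq, hτ.psdPow_eq, traceNorm, habs, tr_smul, hτ.tr_eq_one, mul_one,
    Real.sq_sqrt ht]

end PureStates

/-! ### Passage between the `A_k` and the normalized states. -/

section Normalization

variable {H : Type*} [NormedAddCommGroup H] [InnerProductSpace ℂ H] [CompleteSpace H]

theorem normalized_eq (A : H →L[ℂ] H) : normalized A = (tr A)⁻¹ • A := by
  ext x
  simp only [normalized, smul_apply, Complex.coe_smul]

variable [FiniteDimensional ℂ H]

theorem normalized_nonneg {A : H →L[ℂ] H} (hA : 0 ≤ A) : 0 ≤ normalized A := by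
  rw [normalized_eq]
  exact smul_nonneg (inv_nonneg.2 (tr_nonneg hA)) hA

theorem tr_normalized_le_one (A : H →L[ℂ] H) : tr (normalized A) ≤ 1 := by
  rw [normalized_eq, tr_smul]
  exact inv_mul_le_one

theorem tr_smul_normalized {A : H →L[ℂ] H} (h : tr A ≠ 0) : tr A • normalized A = A := by
  rw [normalized_eq, smul_smul, mul_inv_cancel₀ h, one_smul]

theorem IsPureState.tr_pos_of_normalized {A : H →L[ℂ] H} (hA : 0 ≤ A)
    (h : IsPureState (normalized A)) : 0 < tr A := by
  refine (tr_nonneg hA).lt_of_ne fun h0 => ?_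
  have := h.tr_eq_one
  rw [normalized_eq, ← h0, inv_zero, zero_smul, tr_zero] at this
  exact zero_ne_one this

theorem fidelity_eq_sqrt_mul {A B : H →L[ℂ] H} (hA : 0 ≤ A) (hB : 0 ≤ B) (hA' : 0 < tr A)
    (hB' : 0 < tr B) :
    fidelity A B = √(tr A * tr B) * fidelity (normalized A) (normalized B) := by
  rw [← fidelity_smul (normalized_nonneg hA) (normalized_nonneg hB) hA' hB',
    tr_smul_normalized hA'.ne', tr_smul_normalized hB'.ne']

theorem fidelity_le_sqrt_mul_optError {A B : H →L[ℂ] H} (hA : 0 ≤ A) (hB : 0 ≤ B) :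
    fidelity A B ≤ √(tr A + tr B) * √(optError ![A, B]) := by
  rw [← Real.sqrt_mul (add_nonneg (tr_nonneg hA) (tr_nonneg hB))]
  exact Real.le_sqrt_of_sq_le (sq_fidelity_le_mul_optError hA hB)

/-- This settles the degenerate case of the Chernoff bound: the fidelity vanishes as soon as one
trace does, so no normalization is needed there. -/
theorem sq_fidelity_le_tr_mul_tr {A B : H →L[ℂ] H} (hA : 0 ≤ A) (hB : 0 ≤ B) :
    fidelity A B ^ 2 ≤ tr A * tr B := by
  obtain ⟨U, -, hU', hX⟩ := exists_star_mul_eq_abs (psdPow A (1 / 2) * psdPow B (1 / 2))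
  have h := sq_tr_star_mul_le (psdPow A (1 / 2) * U) (psdPow B (1 / 2))
  rw [star_mul, star_psdPow, star_psdPow, psdPow_half_mul_self hB, mul_assoc, hX] at h
  refine h.trans (mul_le_mul_of_nonneg_right ?_ (tr_nonneg hB))
  rw [← mul_assoc, mul_assoc (star U), psdPow_half_mul_self hA, mul_assoc, tr_mul_comm,
    mul_assoc]
  exact tr_mul_le_tr hA hU'

theorem fidelity_le_sqrt_mul_chernoffQmin {A B : H →L[ℂ] H} (hA : 0 ≤ A) (hB : 0 ≤ B) :
    fidelity A B ≤ √(tr A * tr B) * √(chernoffQmin (normalized A) (normalized B)) := by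
  rcases (mul_nonneg (tr_nonneg hA) (tr_nonneg hB)).eq_or_lt with h | h
  · have h2 := sq_fidelity_le_tr_mul_tr hA hB
    rw [← h] at h2 ⊢
    rw [Real.sqrt_zero, zero_mul]
    exact (pow_eq_zero_iff two_ne_zero).1 (le_antisymm h2 (sq_nonneg _)) |>.le
  · have hA' := pos_of_mul_pos_left h (tr_nonneg hB)
    have hB' := pos_of_mul_pos_right h (tr_nonneg hA)
    rw [fidelity_eq_sqrt_mul hA hB hA' hB']
    gcongr
    exact Real.le_sqrt_of_sq_le (sq_fidelity_le_chernoffQmin (normalized_nonneg hA)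
      (normalized_nonneg hB) (tr_normalized_le_one A) (tr_normalized_le_one B))

theorem tr_psdPow_half_mul_eq {A B : H →L[ℂ] H} (hA : 0 ≤ A) (hB : 0 ≤ B)
    (hσ : IsPureState (normalized A)) (hτ : IsPureState (normalized B)) :
    tr (psdPow A (1 / 2) * psdPow B (1 / 2))
      = √(tr A * tr B) * chernoffQmin (normalized A) (normalized B) := by
  have hA' := hσ.tr_pos_of_normalized hA
  have hB' := hτ.tr_pos_of_normalized hB
  conv_lhs => rw [← tr_smul_normalized hA'.ne', ← tr_smul_normalized hB'.ne',
    psdPow_smul hσ.isPositive hA', psdPow_smul hτ.isPositive hB', hσ.psdPow_eq, hτ.psdPow_eq,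
    smul_mul_smul_comm, tr_smul]
  rw [hσ.chernoffQmin_eq hτ, Real.sqrt_mul hA'.le, Real.sqrt_eq_rpow, Real.sqrt_eq_rpow]

theorem sqrt_mul_chernoffQmin_eq {A B : H →L[ℂ] H} (hA : 0 ≤ A) (hB : 0 ≤ B)
    (hσ : IsPureState (normalized A)) (hτ : IsPureState (normalized B)) :
    √(tr A * tr B) * chernoffQmin (normalized A) (normalized B)
      = 1 / √(tr A * tr B) * fidelity A B ^ 2 := by
  have hA' := hσ.tr_pos_of_normalized hA
  have hB' := hτ.tr_pos_of_normalized hB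
  have : 0 < √(tr A * tr B) := Real.sqrt_pos.2 (mul_pos hA' hB')
  rw [fidelity_eq_sqrt_mul hA hB hA' hB', mul_pow, hσ.sq_fidelity_eq hτ, hσ.chernoffQmin_eq hτ]
  field_simp

end Normalization

end StateDiscrimination

theorem mainTheorem8 {H : Type*} [NormedAddCommGroup H] [InnerProductSpace ℂ H]
    [CompleteSpace H] [FiniteDimensional ℂ H] (r : ℕ) (A : Fin r → H →L[ℂ] H)
    (hA : ∀ i, (A i).IsPositive)
    (p : Fin r → ℝ) (hp : ∀ i, p i = StateDiscrimination.tr (A i))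
    (σ : Fin r → H →L[ℂ] H) (hσ : ∀ i, σ i = StateDiscrimination.normalized (A i)) :
    -- the general (mixed) case
    (StateDiscrimination.optError A ≤
        ∑ q ∈ (Finset.univ : Finset (Fin r)).offDiag, StateDiscrimination.tr
          (StateDiscrimination.psdPow (A q.1) (1 / 2) *
            StateDiscrimination.psdPow (A q.2) (1 / 2)) ∧
      ∑ q ∈ (Finset.univ : Finset (Fin r)).offDiag, StateDiscrimination.tr
          (StateDiscrimination.psdPow (A q.1) (1 / 2) *
            StateDiscrimination.psdPow (A q.2) (1 / 2)) ≤
        ∑ q ∈ (Finset.univ : Finset (Fin r)).offDiag,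
          StateDiscrimination.fidelity (A q.1) (A q.2) ∧
      ∑ q ∈ (Finset.univ : Finset (Fin r)).offDiag,
          StateDiscrimination.fidelity (A q.1) (A q.2) ≤
        ∑ q ∈ (Finset.univ : Finset (Fin r)).offDiag,
          √(p q.1 + p q.2) * √(StateDiscrimination.optError ![A q.1, A q.2]) ∧
      ∑ q ∈ (Finset.univ : Finset (Fin r)).offDiag,
          StateDiscrimination.fidelity (A q.1) (A q.2) ≤
        ∑ q ∈ (Finset.univ : Finset (Fin r)).offDiag,
          √(p q.1 * p q.2) * √(StateDiscrimination.chernoffQmin (σ q.1) (σ q.2))) ∧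
    -- the improved bounds for pure states
    ((∀ i, StateDiscrimination.IsPureState (σ i)) →
      StateDiscrimination.optError A ≤
        ∑ q ∈ (Finset.univ : Finset (Fin r)).offDiag, StateDiscrimination.tr
          (StateDiscrimination.psdPow (A q.1) (1 / 2) *
            StateDiscrimination.psdPow (A q.2) (1 / 2)) ∧
      ∑ q ∈ (Finset.univ : Finset (Fin r)).offDiag, StateDiscrimination.tr
          (StateDiscrimination.psdPow (A q.1) (1 / 2) *
            StateDiscrimination.psdPow (A q.2) (1 / 2)) =
        ∑ q ∈ (Finset.univ : Finset (Fin r)).offDiag,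
          √(p q.1 * p q.2) * StateDiscrimination.chernoffQmin (σ q.1) (σ q.2) ∧
      ∑ q ∈ (Finset.univ : Finset (Fin r)).offDiag,
          √(p q.1 * p q.2) * StateDiscrimination.chernoffQmin (σ q.1) (σ q.2) =
        ∑ q ∈ (Finset.univ : Finset (Fin r)).offDiag,
          1 / √(p q.1 * p q.2) * StateDiscrimination.fidelity (A q.1) (A q.2) ^ 2 ∧
      ∑ q ∈ (Finset.univ : Finset (Fin r)).offDiag,
          1 / √(p q.1 * p q.2) * StateDiscrimination.fidelity (A q.1) (A q.2) ^ 2 ≤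
        ∑ q ∈ (Finset.univ : Finset (Fin r)).offDiag,
          (p q.1 + p q.2) / √(p q.1 * p q.2) *
            StateDiscrimination.optError ![A q.1, A q.2]) := by
  open StateDiscrimination in
  have hA0 : ∀ i, 0 ≤ A i := fun i => (ContinuousLinearMap.nonneg_iff_isPositive _).2 (hA i)
  obtain rfl : p = fun i => tr (A i) := funext hp
  obtain rfl : σ = fun i => normalized (A i) := funext hσ
  refine ⟨⟨optError_le_sum_tr hA0, ?_, ?_, ?_⟩, fun h => ⟨optError_le_sum_tr hA0, ?_, ?_, ?_⟩⟩
  · exact Finset.sum_le_sum fun q _ => tr_le_traceNorm _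
  · exact Finset.sum_le_sum fun q _ => fidelity_le_sqrt_mul_optError (hA0 _) (hA0 _)
  · exact Finset.sum_le_sum fun q _ => fidelity_le_sqrt_mul_chernoffQmin (hA0 _) (hA0 _)
  · exact Finset.sum_congr rfl fun q _ => tr_psdPow_half_mul_eq (hA0 _) (hA0 _) (h _) (h _)
  · exact Finset.sum_congr rfl fun q _ => sqrt_mul_chernoffQmin_eq (hA0 _) (hA0 _) (h _) (h _)
  · refine Finset.sum_le_sum fun q _ => ?_
    -- The last pure-state inequality is the general binary bound divided by `√(p_i p_j)`.
    have := sq_fidelity_le_mul_optError (hA0 q.1) (hA0 q.2)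
    calc _ = fidelity (A q.1) (A q.2) ^ 2 / √(tr (A q.1) * tr (A q.2)) := by ring
      _ ≤ _ := div_le_div_of_nonneg_right this (Real.sqrt_nonneg _)
      _ = _ := by ring
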